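/- For a nonzero integer $r$ define the $r$-Fishburn numbers $\xi_r(n)\in\mathbb{Z}$ by the formal power series identity $$\sum_{n\ge 0}\xi_r(n)q^n=F\big((1-q)^r\big),\qquad F(t)=\sum_{n\ge0}(t;t)_n,\quad (a;t)_n=\prod_{k=0}^{n-1}(1-a t^k).$$ For a prime $p\ge5$, an integer $r$ coprime to $p$ and $0\le s\le p-1$, let $S^*(p,r,s)$ be the set of all $j$ with $0\le j\le p-1$ such that $24(j-s)\not\equiv -r \pmod p$ and $\tfrac12 r n(3n-1)\equiv j-s\pmod p$ for some integer $n$, and let $T^*(p,r,s)$ be the set of all $k$ with $0\le k\le p-1$ that are larger than every element of $S^*(p,r,s)$. Let $p\ge 5$ be prime and let $r$ be a nonzero integer coprime to $p$. Then there are at least $\frac{1}{2}(p+1)$ linearly independent congruence relations mod $p$ of the form $$\sum_{j=0}^{p-1}\alpha_j\,\xi_r(pn+j)\equiv 0\pmod p\quad\text{for all } n\ge 0,\qquad \vec\alpha=(\alpha_0,\dots,\alpha_{p-1})\in\mathbb{F}_p^{\,p}$$ (linear independence being that of the vectors $\vec\alpha$ over $\mathbb{F}_p$). More precisely, let $\overline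 r$ be any integer with $r\overline r\equiv1\pmod p$. There are exactly $\frac12(p+1)$ integers $s$ with $0\le s\le p-1$ for which the Legendre symbol $\left(\frac{-24(1+s)\overline r+1}{p}\right)$ equals $-1$ or $0$. For each such $s$ one has $p-1\in T^*(p,r,s)$ and $$\sum_{j=0}^{s}\binom{s}{j}(-1)^j\,\xi_r(pn+p-1-j)\equiv0\pmod p\qquad\text{for all } n\ge0,$$ and these $\frac12(p+1)$ relations are linearly independent over $\mathbb{F}_p$. -/

import Mathlib

open PowerSeries

/-- The unit `1 - q` of `ℤ⟦q⟧`; its inverse is the geometric series. -/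
noncomputable def oneSubQ : (ℤ⟦X⟧)ˣ where
  val := 1 - X
  inv := PowerSeries.mk 1
  val_inv := by rw [mul_comm]; exact PowerSeries.mk_one_mul_one_sub_eq_one ℤ
  inv_val := PowerSeries.mk_one_mul_one_sub_eq_one ℤ

/-- The `q`-Pochhammer symbol `(a; q)_n = (1 - a) (1 - a q) ⋯ (1 - a q ^ (n - 1))`. -/
def qPoch {R : Type*} [CommRing R] (a q : R) (n : ℕ) : R :=
  ∏ k ∈ Finset.range n, (1 - a * q ^ k)

/-- The power series `(1 - q) ^ r`, for an integer `r` of any sign. -/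
noncomputable def oneSubQPow (r : ℤ) : ℤ⟦X⟧ := ((oneSubQ ^ r : (ℤ⟦X⟧)ˣ) : ℤ⟦X⟧)

/-- The `r`-Fishburn number `ξ_r(N)`: the coefficient of `q ^ N` in `F((1 - q) ^ r)`, where
`F(t) = ∑ n, (t; t)_n`. The `n`-th summand is divisible by `q ^ n`, so only the summands with
`n ≤ N` contribute to that coefficient; `hasSum_rFishburn` below confirms that the generating
series of these numbers is the whole infinite sum. -/
noncomputable def rFishburn (r : ℤ) (N : ℕ) : ℤ :=
  PowerSeries.coeff N (∑ n ∈ Finset.range (N + 1), qPoch (oneSubQPow r) (oneSubQPow r) n)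

theorem constantCoeff_oneSubQPow (r : ℤ) : PowerSeries.constantCoeff (oneSubQPow r) = 1 := by
  have h : Units.map (PowerSeries.constantCoeff (R := ℤ)).toMonoidHom oneSubQ = 1 := by
    ext; simp [oneSubQ]
  have h2 : Units.map (PowerSeries.constantCoeff (R := ℤ)).toMonoidHom (oneSubQ ^ r) = 1 := by
    rw [map_zpow, h, one_zpow]
  exact congrArg Units.val h2

theorem X_pow_dvd_qPoch_oneSubQPow (r : ℤ) (n : ℕ) :
    (X : ℤ⟦X⟧) ^ n ∣ qPoch (oneSubQPow r) (oneSubQPow r) n := by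
  have h : ∀ k ∈ Finset.range n,
      (X : ℤ⟦X⟧) ∣ (1 - oneSubQPow r * oneSubQPow r ^ k) := fun k _ => by
    rw [PowerSeries.X_dvd_iff]
    simp [constantCoeff_oneSubQPow]
  simpa [qPoch] using Finset.prod_dvd_prod_of_dvd _ _ h

open scoped PowerSeries.WithPiTopology in
/-- `∑ N, ξ_r(N) q ^ N = F((1 - q) ^ r) = ∑ n, ((1 - q) ^ r; (1 - q) ^ r)_n` as formal power
series, the infinite sum being taken coefficientwise. -/
theorem hasSum_rFishburn (r : ℤ) :
    HasSum (fun n => qPoch (oneSubQPow r) (oneSubQPow r) n) (PowerSeries.mk (rFishburn r)) := by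
  rw [PowerSeries.WithPiTopology.hasSum_iff_hasSum_coeff]
  intro N
  rw [PowerSeries.coeff_mk, rFishburn, map_sum]
  refine hasSum_sum_of_ne_finset_zero fun n hn => ?_
  exact PowerSeries.X_pow_dvd_iff.mp (X_pow_dvd_qPoch_oneSubQPow r n) N
    (by simpa using hn)

/-- `α ∈ 𝔽_p ^ p` is a congruence relation mod `p` for `ξ_r`:
`∑ j, α_j ξ_r(p n + j) ≡ 0 (mod p)` for all `n ≥ 0`. -/
def IsCongruenceRelation (p : ℕ) (r : ℤ) (α : Fin p → ZMod p) : Prop :=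
  ∀ n : ℕ, ∑ j : Fin p, α j * (rFishburn r (p * n + j) : ZMod p) = 0

/-- `S*(p, r, s)`: the `j` with `0 ≤ j ≤ p - 1` such that `r n (3 n - 1) / 2 ≡ j - s (mod p)` for
some integer `n` and `24 (j - s) ≢ -r (mod p)`. -/
def SStar (p : ℕ) (r : ℤ) (s : ℕ) : Set ℕ :=
  {j | j < p ∧ (∃ n : ℤ, r * (n * (3 * n - 1) / 2) ≡ (j : ℤ) - s [ZMOD p]) ∧
    ¬ 24 * ((j : ℤ) - s) ≡ -r [ZMOD p]}

/-- `T*(p, r, s)`: the `k` with `0 ≤ k ≤ p - 1` that exceed every element of `S*(p, r, s)`. -/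
def TStar (p : ℕ) (r : ℤ) (s : ℕ) : Set ℕ :=
  {k | k < p ∧ ∀ j ∈ SStar p r s, j < k}

/-- The `s` with `0 ≤ s ≤ p - 1` for which the Legendre symbol of `-24 (1 + s) r' + 1` modulo `p`
equals `-1` or `0`. -/
def goodShifts (p : ℕ) [Fact p.Prime] (r' : ℤ) : Finset ℕ :=
  {s ∈ Finset.range p | legendreSym p (-24 * (1 + s) * r' + 1) = -1 ∨
    legendreSym p (-24 * (1 + s) * r' + 1) = 0}

/-- The coefficient vector in `𝔽_p ^ p` of the relation
`∑_{j ≤ s} (s choose j) (-1) ^ j ξ_r(p n + p - 1 - j) ≡ 0`: its entry at the index `p - 1 - j` is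
`(-1) ^ j (s choose j)`. -/
def binomialRelation (p s : ℕ) : Fin p → ZMod p :=
  fun i => (s.choose (p - 1 - i) : ZMod p) * (-1) ^ (p - 1 - (i : ℕ))

/-! Fix `N = p n + p - 1` and an odd `M = p ^ k > N`. In `𝔽_p⟦X⟧ / (X ^ M)` Frobenius gives `(1 - X)
^ M = 1`, so `q = (1 - X) ^ r` satisfies `q ^ M = 1`. For such `q`, a finite form of Zagier's
strange identity (`four_mul_sum_qPoch`) writes `4 ∑ (q; q)_n` as a signed sum of terms `c q ^ e`
with `c ^ 2 = 24 e + 1`. After multiplication by `(1 - X) ^ s`, the coefficient of `X ^ N` in such a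
term is, up to sign, `c` times the binomial coefficient of `r e + s` over `N`. By Lucas it vanishes
mod `p` unless `r e + s ≡ -1`, and then `c ^ 2 ≡ 1 - 24 (1 + s) r'`. If this is zero or a
nonresidue, `c ≡ 0`, so every term vanishes. Expanding `(1 - X) ^ s` gives the binomial relation.
Half of the residues, plus zero, qualify, and the relations are triangular in `s`. -/

/-! ### The strange identity at a root of unity of odd order -/

section PentagonalPolynomial

variable {R : Type*} [CommRing R]

/-- The secondPentagonal number `j (3 j + 1) / 2`. -/
def secondPentagonal (j : ℕ) : ℕ := j * (3 * j + 1) / 2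

theorem two_mul_secondPentagonal (j : ℕ) : 2 * secondPentagonal j = j * (3 * j + 1) := by
  refine Nat.mul_div_cancel' ?_
  rcases Nat.even_or_odd' j with ⟨k, rfl | rfl⟩
  · exact ⟨k * (3 * (2 * k) + 1), by ring⟩
  · exact ⟨(2 * k + 1) * (3 * k + 2), by ring⟩

theorem secondPentagonal_succ (j : ℕ) : secondPentagonal (j + 1) = secondPentagonal j + (3 * j + 2) := by
  have h₁ := two_mul_secondPentagonal j
  have h₂ := two_mul_secondPentagonal (j + 1)
  have : (j + 1) * (3 * (j + 1) + 1) = j * (3 * j + 1) + 2 * (3 * j + 2) := by ring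
  omega

theorem dvd_secondPentagonal_of_odd {M : ℕ} (hM : Odd M) : M ∣ secondPentagonal M := by
  obtain ⟨k, rfl⟩ := hM
  refine ⟨3 * k + 2, ?_⟩
  have h := two_mul_secondPentagonal (2 * k + 1)
  have : (2 * k + 1) * (3 * (2 * k + 1) + 1) = 2 * ((2 * k + 1) * (3 * k + 2)) := by ring
  omega

theorem qPoch_succ (a q : R) (n : ℕ) : qPoch a q (n + 1) = qPoch a q n * (1 - a * q ^ n) :=
  Finset.prod_range_succ _ _

theorem qPoch_succ' (a q : R) (n : ℕ) : qPoch a q (n + 1) = (1 - a) * qPoch (q * a) q n := by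
  rw [qPoch, Finset.prod_range_succ', mul_comm, qPoch, pow_zero, mul_one]
  congr 1
  exact Finset.prod_congr rfl fun k _ => by ring

theorem qPoch_mul_of_pow_eq_one {q : R} {M : ℕ} (hq : q ^ M = 1) (a : R) :
    qPoch (q * a) q M = qPoch a q M := by
  cases M with
  | zero => simp [qPoch]
  | succ m =>
    rw [qPoch_succ, qPoch_succ', mul_comm]
    congr 1
    linear_combination -a * hq

theorem sum_qPoch_succ_mul_pow (x q : R) (N : ℕ) :
    ∑ n ∈ Finset.range N, qPoch x q (n + 1) * x ^ n =
      1 - qPoch (q * x) q N * x ^ N -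
        q * x ^ 2 * ∑ n ∈ Finset.range N, qPoch (q * x) q n * (q * x) ^ n := by
  induction N with
  | zero => simp [qPoch]
  | succ N ih =>
    rw [Finset.sum_range_succ, Finset.sum_range_succ, ih, qPoch_succ' x, qPoch_succ (q * x)]
    ring

theorem sum_qPoch_mul_pow (y q : R) (N : ℕ) :
    ∑ n ∈ Finset.range N, qPoch y q n * y ^ n =
      1 - qPoch y q N * y ^ N + y * ∑ n ∈ Finset.range N, qPoch y q (n + 1) * y ^ n := by
  induction N with
  | zero => simp [qPoch]
  | succ N ih =>
    rw [Finset.sum_range_succ, Finset.sum_range_succ, ih]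
    ring

/-- The truncated sum `∑_{n < M} (x; q)_{n + 1} x ^ n`. -/
def pentagonalSum (q : R) (M : ℕ) (x : R) : R :=
  ∑ n ∈ Finset.range M, qPoch x q (n + 1) * x ^ n

/-- A `q`-difference equation. The two boundary terms of the truncation combine into one factor
because `(x; q)_M` is invariant under `x ↦ q x`. -/
theorem pentagonalSum_eq {q : R} {M : ℕ} (hq : q ^ M = 1) (x : R) :
    pentagonalSum q M x = (1 - qPoch x q M * x ^ M) * (1 - q * x ^ 2) -
      q ^ 2 * x ^ 3 * pentagonalSum q M (q * x) := by
  rw [pentagonalSum, sum_qPoch_succ_mul_pow, sum_qPoch_mul_pow, ← pentagonalSum,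
    qPoch_mul_of_pow_eq_one hq, mul_pow, hq]
  ring

theorem qPoch_pow_mul_of_pow_eq_one {q : R} {M : ℕ} (hq : q ^ M = 1) (a : R) (j : ℕ) :
    qPoch (q ^ j * a) q M = qPoch a q M := by
  induction j with
  | zero => simp
  | succ j ih => rw [pow_succ', mul_assoc, qPoch_mul_of_pow_eq_one hq, ih]

theorem pentagonalSum_eq_sum_add {q : R} {M : ℕ} (hq : q ^ M = 1) (x : R) (J : ℕ) :
    pentagonalSum q M x = (1 - qPoch x q M * x ^ M) *
        ∑ j ∈ Finset.range J,
          (-1) ^ j * q ^ secondPentagonal j * x ^ (3 * j) * (1 - q ^ (2 * j + 1) * x ^ 2) +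
      (-1) ^ J * q ^ secondPentagonal J * x ^ (3 * J) * pentagonalSum q M (q ^ J * x) := by
  induction J with
  | zero => simp [secondPentagonal]
  | succ J ih =>
    have h := pentagonalSum_eq hq (q ^ J * x)
    rw [qPoch_pow_mul_of_pow_eq_one hq, mul_pow _ _ M, ← pow_mul, mul_comm J, pow_mul, hq, one_pow,
      one_mul, ← mul_assoc, ← pow_succ'] at h
    rw [ih, h, Finset.sum_range_succ, secondPentagonal_succ]
    ring

/-- After `M` iterations of the `q`-difference equation the argument `q ^ M x` is `x` again, and the
sign is `-1` as `M` is odd, so the equation closes up. -/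
theorem one_add_mul_pentagonalSum {q : R} {M : ℕ} (hq : q ^ M = 1) (hM : Odd M) (x : R) :
    (1 + x ^ (3 * M)) * pentagonalSum q M x = (1 - qPoch x q M * x ^ M) *
      ∑ j ∈ Finset.range M,
        (-1) ^ j * q ^ secondPentagonal j * x ^ (3 * j) * (1 - q ^ (2 * j + 1) * x ^ 2) := by
  have h := pentagonalSum_eq_sum_add hq x M
  obtain ⟨k, hk⟩ := dvd_secondPentagonal_of_odd hM
  rw [hM.neg_one_pow, hk, pow_mul, hq, one_pow, one_mul] at h
  linear_combination h

/-- Zagier's "strange identity" at an element `q` with `q ^ M = 1`, `M` odd. -/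
theorem four_mul_sum_qPoch {q : R} {M : ℕ} (hq : q ^ M = 1) (hM : Odd M) :
    4 * ∑ n ∈ Finset.range M, qPoch q q n = ∑ j ∈ Finset.range M,
      ((-1) ^ j * (6 * j + 5) * q ^ (secondPentagonal j + (2 * j + 1)) -
        (-1) ^ j * (6 * j + 1) * q ^ secondPentagonal j) := by
  have hq' : (Polynomial.C q) ^ M = 1 := by rw [← map_pow, hq, map_one]
  have h := one_add_mul_pentagonalSum hq' hM Polynomial.X
  have hA : pentagonalSum (Polynomial.C q) M Polynomial.X = (1 - Polynomial.X) *
      ∑ n ∈ Finset.range M, qPoch (Polynomial.C q * Polynomial.X) (Polynomial.C q) n *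
        Polynomial.X ^ n := by
    simp only [pentagonalSum, qPoch_succ', Finset.mul_sum, mul_assoc]
  have hP : (qPoch Polynomial.X (Polynomial.C q) M).eval 1 = 0 := by
    obtain ⟨k, rfl⟩ := hM
    rw [qPoch_succ']
    simp
  have hU (n : ℕ) : (qPoch (Polynomial.C q * Polynomial.X) (Polynomial.C q) n).eval 1 =
      qPoch q q n := by
    simp [qPoch, Polynomial.eval_prod]
  rw [hA] at h
  -- Both sides vanish at `x = 1`, so the content lies in the derivative there. The value shows that
  -- the theta-like sum is zero at `1`, which removes the unknown derivative of `(x; q)_M x ^ M`.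
  have h₀ := congrArg (Polynomial.eval 1) h
  have h₁ := congrArg (fun f => Polynomial.eval 1 (Polynomial.derivative f)) h
  simp only [Polynomial.eval_mul, Polynomial.eval_sub, Polynomial.eval_add, Polynomial.eval_one,
    Polynomial.eval_pow, Polynomial.eval_X, Polynomial.eval_finsetSum, Polynomial.eval_C, hP,
    Polynomial.eval_neg, one_pow, mul_one, sub_self, zero_mul, mul_zero, sub_zero, one_mul] at h₀
  simp only [Polynomial.derivative_mul, Polynomial.derivative_sub, Polynomial.derivative_add,
    Polynomial.derivative_one, Polynomial.derivative_X, Polynomial.eval_mul, Polynomial.eval_sub,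
    Polynomial.eval_add, Polynomial.eval_one,
    Polynomial.eval_pow, Polynomial.eval_X, Polynomial.eval_finsetSum, Polynomial.eval_C, hP, hU,
    Polynomial.eval_neg, one_pow, mul_one, sub_self, zero_mul, mul_zero, sub_zero, one_mul, ← h₀,
    zero_sub, zero_add, add_zero] at h₁
  have h₂ (j : ℕ) : Polynomial.eval 1 (Polynomial.derivative
      ((-1) ^ j * Polynomial.C q ^ secondPentagonal j * Polynomial.X ^ (3 * j) *
        (1 - Polynomial.C q ^ (2 * j + 1) * Polynomial.X ^ 2))) =
      (-1) ^ j * (3 * j) * q ^ secondPentagonal j -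
        (-1) ^ j * (3 * j + 2) * q ^ (secondPentagonal j + (2 * j + 1)) := by
    have : (-1 : Polynomial R) ^ j * Polynomial.C q ^ secondPentagonal j * Polynomial.X ^ (3 * j) *
        (1 - Polynomial.C q ^ (2 * j + 1) * Polynomial.X ^ 2) =
        Polynomial.C ((-1) ^ j * q ^ secondPentagonal j) * Polynomial.X ^ (3 * j) -
        Polynomial.C ((-1) ^ j * q ^ (secondPentagonal j + (2 * j + 1))) *
          Polynomial.X ^ (3 * j + 2) := by
      simp only [map_mul, map_pow, map_neg, map_one]
      ring
    rw [this]
    simp only [Polynomial.derivative_sub, Polynomial.derivative_C_mul_X_pow, Polynomial.eval_sub,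
      Polynomial.eval_mul, Polynomial.eval_C, Polynomial.eval_pow, Polynomial.eval_X, one_pow]
    push_cast
    ring
  rw [Polynomial.derivative_sum, Polynomial.eval_finsetSum, Finset.sum_congr rfl fun j _ => h₂ j]
    at h₁
  -- Subtracting the vanishing sum `h₀` turns `-6 j` and `6 j + 4` into `-(6 j + 1)` and `6 j + 5`,
  -- whose squares are `24 e + 1` for the matching exponents `e`.
  have h₃ : ∑ j ∈ Finset.range M,
      ((-1) ^ j * (6 * j + 5) * q ^ (secondPentagonal j + (2 * j + 1)) -
        (-1) ^ j * (6 * j + 1) * q ^ secondPentagonal j) =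
      -2 * ∑ j ∈ Finset.range M, ((-1) ^ j * (3 * j) * q ^ secondPentagonal j -
        (-1) ^ j * (3 * j + 2) * q ^ (secondPentagonal j + (2 * j + 1))) -
      ∑ j ∈ Finset.range M, (-1) ^ j * q ^ secondPentagonal j * (1 - q ^ (2 * j + 1)) := by
    rw [Finset.mul_sum, ← Finset.sum_sub_distrib]
    exact Finset.sum_congr rfl fun j _ => by ring
  rw [h₃, ← h₀, ← h₁]
  ring

end PentagonalPolynomial

/-! ### Coefficient extraction modulo p -/

section Coefficients

theorem PowerSeries.coeff_one_sub_X_pow {R : Type*} [CommRing R] (e m : ℕ) :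
    coeff m ((1 - X : R⟦X⟧) ^ e) = (e.choose m : R) * (-1) ^ m := by
  induction e generalizing m with
  | zero => cases m <;> simp [coeff_one]
  | succ e ih =>
    rw [pow_succ, mul_sub, mul_one, map_sub]
    cases m with
    | zero => simp [ih]
    | succ m =>
      rw [coeff_succ_mul_X, ih, ih, Nat.choose_succ_succ]
      push_cast
      ring

/-- Lucas: the last base-`p` digit of the lower entry is `p - 1`, which exceeds that of `e` unless
`e ≡ -1`. -/
theorem choose_eq_zero_of_succ_ne_zero {p : ℕ} [Fact p.Prime] {e : ℕ}
    (he : (e + 1 : ZMod p) ≠ 0) (n : ℕ) : (e.choose (p * n + (p - 1)) : ZMod p) = 0 := by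
  have hp := (Fact.out : p.Prime).pos
  have h := (ZMod.natCast_eq_natCast_iff _ _ p).2
    (Choose.choose_modEq_choose_mod_mul_choose_div_nat (n := e) (k := p * n + (p - 1)) (p := p))
  rw [h, Nat.mul_add_mod, Nat.mod_eq_of_lt (by omega : p - 1 < p), Nat.choose_eq_zero_of_lt,
    zero_mul, Nat.cast_zero]
  by_contra hlt
  have hmod : e % p = p - 1 := by
    have := Nat.mod_lt e hp
    omega
  apply he
  have : p ∣ e + 1 := ⟨e / p + 1, by
    have := Nat.div_add_mod e p
    rw [mul_add]
    omega⟩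
  exact_mod_cast (ZMod.natCast_eq_zero_iff _ _).2 this

theorem coeff_sum_qPoch_eq_rFishburn (r : ℤ) {N M : ℕ} (h : N < M) :
    coeff N (∑ n ∈ Finset.range M, qPoch (oneSubQPow r) (oneSubQPow r) n) = rFishburn r N := by
  rw [rFishburn, map_sum, map_sum]
  refine (Finset.sum_subset (Finset.range_subset_range.2 h) fun n _ hn => ?_).symm
  exact X_pow_dvd_iff.mp (X_pow_dvd_qPoch_oneSubQPow r n) N (by simpa using hn)

theorem coeff_one_sub_X_pow_mul_sum_qPoch (r : ℤ) {m M s : ℕ} (hm : m < M) (hs : s ≤ m) :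
    coeff m ((1 - X) ^ s * ∑ n ∈ Finset.range M, qPoch (oneSubQPow r) (oneSubQPow r) n) =
      ∑ j ∈ Finset.range (s + 1), (s.choose j : ℤ) * (-1) ^ j * rFishburn r (m - j) := by
  rw [coeff_mul, Finset.Nat.sum_antidiagonal_eq_sum_range_succ
    (fun i j => coeff i ((1 - X : ℤ⟦X⟧) ^ s) *
      coeff j (∑ n ∈ Finset.range M, qPoch (oneSubQPow r) (oneSubQPow r) n))]
  symm
  rw [Finset.sum_subset (Finset.range_subset_range.2 (Nat.succ_le_succ hs))]
  · refine Finset.sum_congr rfl fun j _ => ?_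
    rw [coeff_one_sub_X_pow, coeff_sum_qPoch_eq_rFishburn r (by omega)]
  · intro j _ hj
    rw [Nat.choose_eq_zero_of_lt (by simpa [Nat.lt_succ_iff] using hj)]
    simp

theorem map_qPoch {R S : Type*} [CommRing R] [CommRing S] (f : R →+* S) (a q : R) (n : ℕ) :
    f (qPoch a q n) = qPoch (f a) (f q) n := by
  simp [qPoch, map_prod]

/-- If `u = 1 - X` has order dividing `M` in a quotient of `ℤ⟦X⟧`, then the exponent of
`(1 - X) ^ r` can be reduced modulo `M`. -/
theorem map_oneSubQPow_eq_pow {R : Type*} [CommRing R] (f : ℤ⟦X⟧ →+* R) {M : ℕ}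
    (hM : (M : ℤ) ≠ 0) (h : f (1 - X) ^ M = 1) (r : ℤ) :
    f (oneSubQPow r) = f (1 - X) ^ (r % M).toNat := by
  have hu : (Units.map f.toMonoidHom oneSubQ) ^ M = 1 := by
    ext
    simpa [oneSubQ] using h
  have hr : ((r % M).toNat : ℤ) = r % M := Int.toNat_of_nonneg (Int.emod_nonneg _ hM)
  have key : (Units.map f.toMonoidHom oneSubQ) ^ r =
      (Units.map f.toMonoidHom oneSubQ) ^ (r % M).toNat := by
    rw [← zpow_natCast, hr]
    conv_lhs => rw [← Int.emod_add_mul_ediv r M, zpow_add, zpow_mul, zpow_natCast, hu, one_zpow,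
      mul_one]
  rw [← map_zpow] at key
  exact congrArg Units.val key

theorem sq_six_mul_add_one (j : ℕ) : (6 * j + 1) ^ 2 = 24 * secondPentagonal j + 1 := by
  linarith [two_mul_secondPentagonal j]

theorem sq_six_mul_add_five (j : ℕ) :
    (6 * j + 5) ^ 2 = 24 * (secondPentagonal j + (2 * j + 1)) + 1 := by
  linarith [two_mul_secondPentagonal j]

variable {p : ℕ} [Fact p.Prime]

theorem mul_coeff_one_sub_X_pow_eq_zero {r r' : ZMod p} (hr : r * r' = 1) {s : ℕ}
    (hs : ∀ m : ZMod p, m ≠ 0 → m ^ 2 ≠ -24 * (1 + s) * r' + 1) {r₀ : ℕ} (hr₀ : (r₀ : ZMod p) = r)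
    {c e : ℕ} (hc : c ^ 2 = 24 * e + 1) (n : ℕ) :
    (c : ZMod p) * coeff (p * n + (p - 1)) ((1 - X : (ZMod p)⟦X⟧) ^ (r₀ * e + s)) = 0 := by
  by_cases h0 : (c : ZMod p) = 0
  · rw [h0, zero_mul]
  rw [coeff_one_sub_X_pow, choose_eq_zero_of_succ_ne_zero, zero_mul, mul_zero]
  intro h
  refine hs c h0 ?_
  have hc' : (c : ZMod p) ^ 2 = 24 * e + 1 := by exact_mod_cast congrArg (Nat.cast (R := ZMod p)) hc
  push_cast at h
  rw [hr₀] at h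
  linear_combination hc' + 24 * r' * h - 24 * e * hr

theorem coeff_map_one_sub_X_pow_mul_sum_qPoch (hp : 5 ≤ p) {r : ℤ} {r' : ZMod p}
    (hr : (r : ZMod p) * r' = 1) {s : ℕ}
    (hs : ∀ m : ZMod p, m ≠ 0 → m ^ 2 ≠ -24 * (1 + s) * r' + 1) {n k : ℕ}
    (hk : p * n + (p - 1) < p ^ k) :
    ((coeff (p * n + (p - 1)) ((1 - X) ^ s * ∑ n ∈ Finset.range (p ^ k),
      qPoch (oneSubQPow r) (oneSubQPow r) n) : ℤ) : ZMod p) = 0 := by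
  have hprime : p.Prime := Fact.out
  have hk0 : k ≠ 0 := by
    rintro rfl
    rw [pow_zero] at hk
    omega
  have hodd : Odd (p ^ k) := (hprime.odd_of_ne_two (by omega)).pow
  set M := p ^ k with hM
  have hM0 : (M : ℤ) ≠ 0 := by exact_mod_cast (pow_pos hprime.pos k).ne'
  set m := p * n + (p - 1) with hm
  set φ := PowerSeries.map (Int.castRingHom (ZMod p))
  set I : Ideal (ZMod p)⟦X⟧ := Ideal.span {X ^ M}
  set π := Ideal.Quotient.mk I
  have hφX : φ (1 - X) = 1 - X := by simp [φ]
  -- Frobenius: `(1 - X) ^ M = 1 - X ^ M`, which is `1` in the quotient.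
  have hu : (π.comp φ) (1 - X) ^ M = 1 := by
    rw [RingHom.comp_apply, hφX, ← map_pow, hM]
    have : CharP (ZMod p)⟦X⟧ p := charP_of_injective_algebraMap
      (algebraMap (ZMod p) (ZMod p)⟦X⟧).injective p
    rw [sub_pow_char_pow, one_pow, map_sub, map_one, sub_eq_self]
    exact Ideal.Quotient.eq_zero_iff_mem.2 (Ideal.mem_span_singleton_self _)
  set r₀ := (r % M).toNat with hr₀def
  have hr₀ : (r₀ : ZMod p) = r := by
    have h1 : (r₀ : ℤ) = r % M := Int.toNat_of_nonneg (Int.emod_nonneg _ hM0)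
    have h2 : ((r₀ : ℤ) : ZMod p) = r := by
      rw [h1, ZMod.intCast_eq_intCast_iff]
      refine (Int.mod_modEq r M).of_dvd ?_
      exact_mod_cast dvd_pow_self p hk0
    exact_mod_cast h2
  have hq : (π.comp φ) (oneSubQPow r) ^ M = 1 := by
    rw [map_oneSubQPow_eq_pow _ hM0 hu, ← pow_mul, mul_comm, pow_mul, hu, one_pow]
  have key := four_mul_sum_qPoch hq hodd
  have hcoeff : ∀ f g : (ZMod p)⟦X⟧, π f = π g → coeff m f = coeff m g := by
    intro f g hfg
    have := X_pow_dvd_iff.1 (Ideal.mem_span_singleton.1 ((Ideal.Quotient.mk_eq_mk_iff_sub_mem _ _).1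
      hfg)) m hk
    rwa [map_sub, sub_eq_zero] at this
  have h := hcoeff (4 * φ ((1 - X) ^ s * ∑ n ∈ Finset.range M,
      qPoch (oneSubQPow r) (oneSubQPow r) n))
    (∑ j ∈ Finset.range M,
      ((-1) ^ j * (((6 * j + 5 : ℕ) : (ZMod p)⟦X⟧) *
          (1 - X) ^ (r₀ * (secondPentagonal j + (2 * j + 1)) + s)) -
        (-1) ^ j * (((6 * j + 1 : ℕ) : (ZMod p)⟦X⟧) *
          (1 - X) ^ (r₀ * secondPentagonal j + s)))) (by
    have e1 : π (4 * φ ((1 - X) ^ s * ∑ n ∈ Finset.range M,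
        qPoch (oneSubQPow r) (oneSubQPow r) n)) = π (1 - X) ^ s * (4 * ∑ n ∈ Finset.range M,
          qPoch ((π.comp φ) (oneSubQPow r)) ((π.comp φ) (oneSubQPow r)) n) := by
      simp only [← map_qPoch, ← map_sum, RingHom.comp_apply, map_mul, map_pow, hφX, map_ofNat]
      ring
    rw [e1, key, map_oneSubQPow_eq_pow _ hM0 hu, ← hr₀def, RingHom.comp_apply, hφX, Finset.mul_sum,
      map_sum]
    refine Finset.sum_congr rfl fun j _ => ?_
    simp only [map_sub, map_mul, map_pow, map_neg, map_one, map_natCast]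
    push_cast
    ring)
  have hterm : ∀ (j c e : ℕ), c ^ 2 = 24 * e + 1 → coeff m ((-1) ^ j * (((c : ℕ) : (ZMod p)⟦X⟧) *
      (1 - X) ^ (r₀ * e + s))) = 0 := by
    intro j c e hc
    have h1 : ((-1) ^ j * (((c : ℕ) : (ZMod p)⟦X⟧) * (1 - X) ^ (r₀ * e + s))) =
        C ((-1) ^ j * (c : ZMod p)) * (1 - X) ^ (r₀ * e + s) := by
      simp only [map_mul, map_pow, map_neg, map_one, map_natCast]
      ring
    rw [h1, coeff_C_mul, mul_assoc, hm, mul_coeff_one_sub_X_pow_eq_zero hr hs hr₀ hc, mul_zero]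
  have hzero := fun j => (map_sub (coeff m) _ _).trans <| (congrArg₂ (· - ·)
    (hterm j _ _ (sq_six_mul_add_five j)) (hterm j _ _ (sq_six_mul_add_one j))).trans (sub_zero 0)
  rw [map_sum, Finset.sum_eq_zero fun j _ => hzero j] at h
  have h4 : (4 : (ZMod p)⟦X⟧) = C 4 := (map_ofNat C 4).symm
  rw [h4, coeff_C_mul, PowerSeries.coeff_map] at h
  refine (mul_eq_zero.1 h).resolve_left fun h0 => ?_
  have h5 : ((4 : ℕ) : ZMod p) = 0 := by exact_mod_cast h0
  have := Nat.le_of_dvd (by norm_num) ((ZMod.natCast_eq_zero_iff _ _).1 h5)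
  omega

theorem sum_choose_mul_rFishburn_modEq (hp : 5 ≤ p) {r : ℤ} {r' : ZMod p}
    (hr : (r : ZMod p) * r' = 1) {s : ℕ} (hsp : s < p)
    (hs : ∀ m : ZMod p, m ≠ 0 → m ^ 2 ≠ -24 * (1 + s) * r' + 1) (n : ℕ) :
    ∑ j ∈ Finset.range (s + 1),
      (s.choose j : ℤ) * (-1) ^ j * rFishburn r (p * n + (p - 1) - j) ≡ 0 [ZMOD p] := by
  have hk : p * n + (p - 1) < p ^ (p * n + (p - 1)) := Nat.lt_pow_self (by omega)
  rw [← coeff_one_sub_X_pow_mul_sum_qPoch r hk (by omega), ← ZMod.intCast_eq_intCast_iff,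
    coeff_map_one_sub_X_pow_mul_sum_qPoch hp hr hs hk, Int.cast_zero]

end Coefficients

/-! ### Independence, counting of shifts, and T* -/

section Relations

variable {p : ℕ} [Fact p.Prime]

theorem isCongruenceRelation_binomialRelation {r : ℤ} {s : ℕ} (hsp : s < p)
    (h : ∀ n : ℕ, ∑ j ∈ Finset.range (s + 1),
      (s.choose j : ℤ) * (-1) ^ j * rFishburn r (p * n + (p - 1) - j) ≡ 0 [ZMOD p]) :
    IsCongruenceRelation p r (binomialRelation p s) := by
  intro n
  have h' := (ZMod.intCast_eq_intCast_iff _ _ p).2 (h n)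
  push_cast at h'
  rw [← h']
  simp only [binomialRelation]
  rw [Fin.sum_univ_eq_sum_range (fun i => ((s.choose (p - 1 - i) : ℕ) : ZMod p) *
    (-1) ^ (p - 1 - i) * (rFishburn r (p * n + i) : ZMod p)), ← Finset.sum_range_reflect]
  symm
  rw [Finset.sum_subset (Finset.range_subset_range.2 (show s + 1 ≤ p from hsp))]
  · refine Finset.sum_congr rfl fun j hj => ?_
    have := Finset.mem_range.1 hj
    rw [show p - 1 - (p - 1 - j) = j by omega, show p * n + (p - 1 - j) = p * n + (p - 1) - j by
      omega]
  · intro j _ hj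
    rw [Nat.choose_eq_zero_of_lt (by simpa [Nat.lt_succ_iff] using hj)]
    simp

theorem linearIndependent_binomialRelation :
    LinearIndependent (ZMod p) (fun s : Fin p => binomialRelation p s) := by
  -- With columns reversed this is the signed Pascal matrix: lower triangular with `±1` on the
  -- diagonal.
  have hdet : (Matrix.of fun s i : Fin p => binomialRelation p s (Fin.rev i)).det ≠ 0 := by
    rw [Matrix.det_of_isLowerTriangular]
    · rw [Finset.prod_ne_zero_iff]
      intro i _
      have : p - 1 - (p - (i + 1)) = i := by omega
      simp [binomialRelation, this]
    · intro i j hij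
      have : p - 1 - (p - (j + 1)) = j := by omega
      have hij' : (i : ℕ) < j := by simpa using hij
      simp [binomialRelation, this, Nat.choose_eq_zero_of_lt hij']
  have h := Matrix.linearIndependent_rows_of_det_ne_zero hdet
  exact LinearIndependent.of_comp (LinearMap.funLeft (ZMod p) (ZMod p) Fin.rev) h

theorem card_filter_quadraticChar (hp : p ≠ 2) :
    (Finset.univ.filter fun a : ZMod p => quadraticChar (ZMod p) a = -1 ∨
      quadraticChar (ZMod p) a = 0).card = (p + 1) / 2 := by
  have hsum := quadraticChar_sum_zero (F := ZMod p) (by rwa [ZMod.ringChar_zmod_n])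
  -- Summed over `a`, where the character sums to zero, this reads `0 = p + 1 - 2 · count`.
  have hone : ∀ a : ZMod p, quadraticChar (ZMod p) a =
      1 + (if a = 0 then 1 else 0) -
        2 * (if quadraticChar (ZMod p) a = -1 ∨ quadraticChar (ZMod p) a = 0 then 1 else 0) := by
    intro a
    by_cases ha : a = 0
    · simp [ha]
    · rcases quadraticChar_dichotomy ha with h | h <;> simp [h, ha]
  rw [Finset.sum_congr rfl fun a _ => hone a, Finset.sum_sub_distrib, Finset.sum_add_distrib,
    ← Finset.mul_sum, Finset.sum_boole, Finset.sum_boole, Finset.filter_eq' Finset.univ] at hsum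
  simp only [Finset.sum_const, Finset.card_univ, ZMod.card, Finset.mem_univ, if_true,
    nsmul_eq_mul, mul_one, Finset.card_singleton] at hsum
  omega

theorem card_goodShifts (hp : 5 ≤ p) {r' : ℤ} (hr' : (r' : ZMod p) ≠ 0) :
    (goodShifts p r').card = (p + 1) / 2 := by
  have hprime : p.Prime := Fact.out
  have h24 : (24 : ZMod p) ≠ 0 := by
    intro h
    have h1 : ((2 ^ 3 * 3 : ℕ) : ZMod p) = 0 := by
      norm_num
      exact h
    rcases (Nat.Prime.dvd_mul hprime).1 ((ZMod.natCast_eq_zero_iff _ _).1 h1) with h | h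
    · have := Nat.le_of_dvd (by norm_num) (hprime.dvd_of_dvd_pow h)
      omega
    · have := Nat.le_of_dvd (by norm_num) h
      omega
  rw [← card_filter_quadraticChar (p := p) (by omega)]
  have hcast (s : ℕ) : ((-24 * (1 + s) * r' + 1 : ℤ) : ZMod p) = -24 * (1 + s) * r' + 1 := by
    push_cast
    ring
  refine Finset.card_bij (fun s _ => -24 * (1 + s) * r' + 1) ?_ ?_ ?_
  · intro s hs
    have := (Finset.mem_filter.1 hs).2
    rw [legendreSym, hcast] at this
    simpa using this
  · intro s hs t ht h
    have h1 : ((24 : ZMod p) * r') * ((t : ZMod p) - s) = 0 := by linear_combination h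
    have h2 := (mul_eq_zero.1 h1).resolve_left (mul_ne_zero h24 hr')
    have h3 := (ZMod.natCast_eq_natCast_iff' _ _ _).1 (sub_eq_zero.1 h2)
    have hs' := Finset.mem_range.1 (Finset.mem_filter.1 hs).1
    have ht' := Finset.mem_range.1 (Finset.mem_filter.1 ht).1
    rw [Nat.mod_eq_of_lt hs', Nat.mod_eq_of_lt ht'] at h3
    exact h3.symm
  · intro b hb
    have hval : -24 * (1 + (((1 - b) * (24 * (r' : ZMod p))⁻¹ - 1).val : ZMod p)) * r' + 1 = b := by
      rw [ZMod.natCast_zmod_val]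
      field_simp
      ring
    refine ⟨((1 - b) * (24 * (r' : ZMod p))⁻¹ - 1).val, ?_, hval⟩
    refine Finset.mem_filter.2 ⟨Finset.mem_range.2 (ZMod.val_lt _), ?_⟩
    rw [legendreSym, hcast, hval]
    simpa using hb

theorem sq_ne_of_mem_goodShifts {r' : ℤ} {s : ℕ} (hs : s ∈ goodShifts p r') (m : ZMod p)
    (hm : m ≠ 0) : m ^ 2 ≠ -24 * (1 + s) * r' + 1 := by
  intro h
  have hcast : ((-24 * (1 + s) * r' + 1 : ℤ) : ZMod p) = m ^ 2 := by
    rw [h]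
    push_cast
    ring
  have := (Finset.mem_filter.1 hs).2
  rw [legendreSym, hcast, quadraticChar_sq_one' hm] at this
  norm_num at this

/-- If `p - 1` lay in `SStar p r s`, completing the square would make `(6 n - 1) ^ 2` equal to the
excluded value; the condition `24 (j - s) ≢ -r` says exactly that `6 n - 1 ≢ 0`. -/
theorem sub_one_mem_TStar {r : ℤ} {r' : ZMod p} (hr : (r : ZMod p) * r' = 1) {s : ℕ}
    (hs : ∀ m : ZMod p, m ≠ 0 → m ^ 2 ≠ -24 * (1 + s) * r' + 1) : p - 1 ∈ TStar p r s := by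
  have hp := (Fact.out : p.Prime).pos
  refine ⟨by omega, ?_⟩
  rintro j ⟨hj, ⟨n, hn⟩, hne⟩
  by_contra hlt
  obtain rfl : j = p - 1 := by omega
  obtain ⟨e, he⟩ : ∃ e, n * (3 * n - 1) = 2 * e := by
    rcases Int.even_or_odd' n with ⟨k, rfl | rfl⟩
    · exact ⟨k * (3 * (2 * k) - 1), by ring⟩
    · exact ⟨(2 * k + 1) * (3 * k + 1), by ring⟩
  rw [he, Int.mul_ediv_cancel_left _ two_ne_zero, ← ZMod.intCast_eq_intCast_iff] at hn
  rw [← ZMod.intCast_eq_intCast_iff] at hne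
  have hp1 : ((p - 1 : ℕ) : ZMod p) = -1 := by
    rw [Nat.cast_sub hp]
    simp
  have he' := congrArg (Int.cast (R := ZMod p)) he
  push_cast at hn hne he'
  rw [hp1] at hn hne
  refine hs (6 * n - 1) (fun h0 => hne ?_) ?_
  · linear_combination -24 * hn + r * (6 * n - 1) * h0 - 12 * r * he'
  · linear_combination 12 * he' + 24 * r' * hn - 24 * e * hr

end Relations

theorem mainTheorem3 (p : ℕ) [Fact p.Prime] (hp : 5 ≤ p) (r : ℤ) (hr : r ≠ 0)
    (hrp : IsCoprime r (p : ℤ)) :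
    -- there are at least `(p + 1) / 2` linearly independent congruence relations
    (∃ v : Fin ((p + 1) / 2) → (Fin p → ZMod p),
      LinearIndependent (ZMod p) v ∧ ∀ i, IsCongruenceRelation p r (v i)) ∧
    -- and such relations come from `m = p - 1` and the shifts `s` selected by the Legendre symbol
    ∀ r' : ℤ, r * r' ≡ 1 [ZMOD p] →
      (goodShifts p r').card = (p + 1) / 2 ∧
      (∀ s ∈ goodShifts p r', p - 1 ∈ TStar p r s ∧
        (∀ n : ℕ, ∑ j ∈ Finset.range (s + 1),
          (s.choose j : ℤ) * (-1) ^ j * rFishburn r (p * n + (p - 1) - j) ≡ 0 [ZMOD p]) ∧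
        IsCongruenceRelation p r (binomialRelation p s)) ∧
      LinearIndependent (ZMod p) (fun s : goodShifts p r' => binomialRelation p s) := by
  have main : ∀ r' : ℤ, r * r' ≡ 1 [ZMOD p] →
      (goodShifts p r').card = (p + 1) / 2 ∧
      (∀ s ∈ goodShifts p r', p - 1 ∈ TStar p r s ∧
        (∀ n : ℕ, ∑ j ∈ Finset.range (s + 1),
          (s.choose j : ℤ) * (-1) ^ j * rFishburn r (p * n + (p - 1) - j) ≡ 0 [ZMOD p]) ∧
        IsCongruenceRelation p r (binomialRelation p s)) ∧
      LinearIndependent (ZMod p) (fun s : goodShifts p r' => binomialRelation p s) := by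
    intro r' hr'
    have hrr : (r : ZMod p) * r' = 1 := by
      exact_mod_cast (ZMod.intCast_eq_intCast_iff _ _ p).2 hr'
    have hlt : ∀ s ∈ goodShifts p r', s < p := fun s hs =>
      Finset.mem_range.1 (Finset.mem_filter.1 hs).1
    refine ⟨card_goodShifts hp (right_ne_zero_of_mul_eq_one hrr), fun s hs => ?_, ?_⟩
    · have hsq := sq_ne_of_mem_goodShifts hs
      have h := sum_choose_mul_rFishburn_modEq hp hrr (hlt s hs) hsq
      exact ⟨sub_one_mem_TStar hrr hsq, h, isCongruenceRelation_binomialRelation (hlt s hs) h⟩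
    · exact linearIndependent_binomialRelation.comp
        (fun s : goodShifts p r' => (⟨s, hlt s s.2⟩ : Fin p))
        fun s t h => Subtype.ext (congrArg Fin.val h)
  refine ⟨?_, main⟩
  obtain ⟨a, b, hab⟩ := hrp
  obtain ⟨hcard, hrel, hli⟩ := main a
    ((Int.modEq_iff_dvd).2 ⟨b, by linear_combination hab.symm⟩)
  let e : Fin ((p + 1) / 2) ≃ goodShifts p a := (finCongr hcard.symm).trans (Finset.equivFin _).symm
  exact ⟨fun i => binomialRelation p (e i), hli.comp e e.injective,
    fun i => (hrel (e i) (e i).2).2.2⟩
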